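/- **Definitions.** In an incidence structure of points and lines, call two points \emph{neighbours}, $P\sim Q$, if there are at least two lines incident with both of them ($P=Q$ allowed). An \emph{epimorphism} of incidence structures is an incidence-preserving map that is surjective on points and on lines. A \emph{projective Hjelmslev plane} is an incidence structure in which any two points lie on a common line, any two lines have a common point, and for which there is an epimorphism $\phi$ onto an ordinary projective plane such that $\phi(P)=\phi(Q)\iff P\sim Q$ for points, and $\phi(g)=\phi(h)\iff g\sim h$ for lines, where $g\sim h$ means that $g$ and $h$ have at least two common points. It is a $(t,r)$-PH plane if for every line $g$ and every point $P$ on $g$ exactly $t$ points of $g$ (including $P$) are neighbours of $P$, and the associated projective plane is finite of order $r$. An \emph{affine Hjelmslev plane} is an incidence structure in which any two points lie on a common line, and for which there is an epimorphism $\phi$ onto an ordinary affine plane such that $\phi(P)=\phi(Q)\iff P\sim Q$ for points, any two lines $g,h$ with at least two common points satisfy $\phi(g)=\phi(h)$, and any two lines $g,h$ without a common point satisfy $\phi(g)\parallel\phi(h)$ (that is, $\phi(g)$ and $\phi(h)$ are equal or disjoint). It is a $(t,r)$-AH plane if for every line $g$ and every point $P$ on $g$ exactly $t$ points of $g$ (including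 $P$) are neighbours of $P$, and every line has exactly $rt$ points. **Statement.** Let $t$ be a natural number. Every $(t,t)$-AH plane $\mathcal{H}$ is a sub-geometry of a $(t,t)$-PH plane and extends to it: there are a $(t,t)$-PH plane $\mathcal{H}'$, a line $m$ of $\mathcal{H}'$, and injective maps from the points and from the lines of $\mathcal{H}$ to those of $\mathcal{H}'$ which preserve and reflect incidence, such that the image of $\mathcal{H}$ is exactly the truncation of $\mathcal{H}'$ obtained by removing all the lines neighbouring $m$ together with all the points incident with at least one of them. -/

import Mathlib

/-!
Incidence structures are pairs of types `Pt` (points) and `Ln` (lines) with an incidence relation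
`P ∈ g`, given by `[Membership Pt Ln]`.
-/

universe u v

namespace Hjelmslev

/-- Two points are neighbours if they are both incident with at least two lines. -/
def PointNeighbour (Pt : Type u) (Ln : Type v) [Membership Pt Ln] (P Q : Pt) : Prop :=
  ∃ g h : Ln, g ≠ h ∧ P ∈ g ∧ Q ∈ g ∧ P ∈ h ∧ Q ∈ h

/-- Two lines of a projective Hjelmslev plane are neighbours if they meet in at least two points. -/
def LineNeighbour (Pt : Type u) (Ln : Type v) [Membership Pt Ln] (g h : Ln) : Prop :=
  ∃ P Q : Pt, P ≠ Q ∧ P ∈ g ∧ Q ∈ g ∧ P ∈ h ∧ Q ∈ h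

/-- Two lines of an ordinary affine plane are parallel if they are equal or have no common point. -/
def Parallel (Pt : Type u) (Ln : Type v) [Membership Pt Ln] (g h : Ln) : Prop :=
  g = h ∨ ∀ P : Pt, ¬ (P ∈ g ∧ P ∈ h)

/-- Ordinary affine planes. -/
structure IsAffinePlane (Pt : Type u) (Ln : Type v) [Membership Pt Ln] : Prop where
  existsUnique_line : ∀ P Q : Pt, P ≠ Q → ∃! g : Ln, P ∈ g ∧ Q ∈ g
  existsUnique_parallel : ∀ (P : Pt) (g : Ln), P ∉ g →
    ∃! h : Ln, P ∈ h ∧ ∀ Q : Pt, ¬ (Q ∈ g ∧ Q ∈ h)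
  exists_triangle : ∃ P Q R : Pt, P ≠ Q ∧ P ≠ R ∧ Q ≠ R ∧ ∀ g : Ln, ¬ (P ∈ g ∧ Q ∈ g ∧ R ∈ g)

/-- Epimorphisms of incidence structures: surjective on points and on lines, and
incidence-preserving. -/
structure IsEpimorphism {Pt : Type u} {Ln : Type v} [Membership Pt Ln]
    {Pt' : Type u} {Ln' : Type v} [Membership Pt' Ln'] (φ : Pt → Pt') (ψ : Ln → Ln') : Prop where
  surjective_points : Function.Surjective φ
  surjective_lines : Function.Surjective ψ
  map_mem : ∀ (P : Pt) (g : Ln), P ∈ g → φ P ∈ ψ g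

/-- `(φ, ψ)` is an epimorphism that makes `(Pt, Ln)` a projective Hjelmslev plane over the
incidence structure `(Pt', Ln')` (which will be an ordinary projective plane). -/
structure IsProjectiveOver {Pt : Type u} {Ln : Type v} [Membership Pt Ln]
    {Pt' : Type u} {Ln' : Type v} [Membership Pt' Ln'] (φ : Pt → Pt') (ψ : Ln → Ln') : Prop where
  exists_line : ∀ P Q : Pt, ∃ g : Ln, P ∈ g ∧ Q ∈ g
  exists_point : ∀ g h : Ln, ∃ P : Pt, P ∈ g ∧ P ∈ h
  epi : IsEpimorphism φ ψ
  points_eq_iff : ∀ P Q : Pt, φ P = φ Q ↔ PointNeighbour Pt Ln P Q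
  lines_eq_iff : ∀ g h : Ln, ψ g = ψ h ↔ LineNeighbour Pt Ln g h

/-- `(φ, ψ)` is an epimorphism that makes `(Pt, Ln)` an affine Hjelmslev plane over the
incidence structure `(Pt', Ln')` (which will be an ordinary affine plane). Lines of an affine
Hjelmslev plane are neighbours if they have the same image; lines which meet in more than one
point have to be neighbours, but neighbouring lines may be disjoint. -/
structure IsAffineOver {Pt : Type u} {Ln : Type v} [Membership Pt Ln]
    {Pt' : Type u} {Ln' : Type v} [Membership Pt' Ln'] (φ : Pt → Pt') (ψ : Ln → Ln') : Prop where
  exists_line : ∀ P Q : Pt, ∃ g : Ln, P ∈ g ∧ Q ∈ g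
  epi : IsEpimorphism φ ψ
  points_eq_iff : ∀ P Q : Pt, φ P = φ Q ↔ PointNeighbour Pt Ln P Q
  lines_eq : ∀ (g h : Ln) (P Q : Pt), P ≠ Q → P ∈ g → Q ∈ g → P ∈ h → Q ∈ h → ψ g = ψ h
  parallel_of_disjoint : ∀ g h : Ln, (∀ P : Pt, ¬ (P ∈ g ∧ P ∈ h)) → Parallel Pt' Ln' (ψ g) (ψ h)

/-- For every point `P` on every line `g`, exactly `t` points of `g` are neighbours of `P`
(`P` itself being one of them). -/
def NeighbourCount (Pt : Type u) (Ln : Type v) [Membership Pt Ln] (t : ℕ) : Prop :=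
  ∀ (g : Ln) (P : Pt), P ∈ g → {Q : Pt | Q ∈ g ∧ PointNeighbour Pt Ln P Q}.encard = t

/-- `(t, r)`-PH planes: projective Hjelmslev planes with `t` neighbouring points on each line,
whose associated ordinary projective plane is finite of order `r`. -/
def IsPHPlane (t r : ℕ) (Pt : Type u) (Ln : Type v) [Membership Pt Ln] : Prop :=
  NeighbourCount Pt Ln t ∧
  ∃ (Pt' : Type u) (Ln' : Type v) (_ : Membership Pt' Ln')
    (_ : Configuration.ProjectivePlane Pt' Ln') (φ : Pt → Pt') (ψ : Ln → Ln'),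
    IsProjectiveOver φ ψ ∧ Finite Pt' ∧ Finite Ln' ∧
      Configuration.ProjectivePlane.order Pt' Ln' = r

/-- `(t, r)`-AH planes: affine Hjelmslev planes with `t` neighbouring points on each line and
`s = r * t` points on each line. -/
def IsAHPlane (t r : ℕ) (Pt : Type u) (Ln : Type v) [Membership Pt Ln] : Prop :=
  NeighbourCount Pt Ln t ∧ (∀ g : Ln, {P : Pt | P ∈ g}.encard = (r * t : ℕ)) ∧
  ∃ (Pt' : Type u) (Ln' : Type v) (_ : Membership Pt' Ln') (φ : Pt → Pt') (ψ : Ln → Ln'),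
    IsAffinePlane Pt' Ln' ∧ IsAffineOver φ ψ

/-- `(i, j)` embeds `(Pt, Ln)` as a sub-geometry of `(Pt', Ln')`. -/
structure IsSubgeometry {Pt : Type u} {Ln : Type v} [Membership Pt Ln]
    {Pt' : Type u} {Ln' : Type v} [Membership Pt' Ln'] (i : Pt → Pt') (j : Ln → Ln') : Prop where
  injective_points : Function.Injective i
  injective_lines : Function.Injective j
  mem_iff : ∀ (P : Pt) (g : Ln), i P ∈ j g ↔ P ∈ g

/-- The image of `(i, j)` is the truncation of `(Pt', Ln')` along the line `m`: the lines
neighbouring `m`, and all the points incident with such a line, are removed. -/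
structure IsTruncation {Pt : Type u} {Ln : Type v}
    {Pt' : Type u} {Ln' : Type v} [Membership Pt' Ln'] (m : Ln')
    (i : Pt → Pt') (j : Ln → Ln') : Prop where
  range_points : Set.range i = {P | ∀ g : Ln', LineNeighbour Pt' Ln' g m → P ∉ g}
  range_lines : Set.range j = {g | ¬ LineNeighbour Pt' Ln' g m}

end Hjelmslev

/-! Let A be the affine plane below the given plane. A line has t * t points in neighbour segments
of t, so A has order t, and a neighbour class has at most t² points. Choosing one line through P
over each of the t + 1 lines of A through the image of P already gives (t + 1)(t - 1) + 1 = t²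
points of the class. Hence there is no room for more, and two lines over the same line of A that
share a point share its whole segment (`mem_of_neighbour`). Counting then gives a parallel axiom for
the lines over a fixed line l of A (`existsUnique_parallel`): they fall into t parallel classes,
each with exactly one line through every point over l.

At infinity, one copy of A is added for every direction d. A line over l, of direction d, is
continued into that copy by a line of A, its label. The t lines l of direction d are matched with
the t directions τ l ≠ d, and the t parallel classes over l with the t lines of direction τ l
(`exists_labelling`). So parallel lines over l share their label, intersecting ones have disjoint
labels, and labels over distinct lines of direction d meet in one point. The lines of direction d in
copy d are left over; they carry the new lines, one for each point Y of A, which meets every copy d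
in the line of direction d through Y. Joins and meets at infinity are thereby read off in A, and the
extension lies over the projective closure of A. -/

namespace Hjelmslev

universe w x

/-! ### Ordinary affine planes -/

/-- The parallel classes of lines. -/
def Direction (PA : Type w) (LA : Type x) [Membership PA LA] : Type x :=
  Quot (Parallel PA LA)

/-- The parallel class of a line. -/
def dir {PA : Type w} {LA : Type x} [Membership PA LA] (l : LA) : Direction PA LA :=
  Quot.mk _ l

theorem dir_surjective {PA : Type w} {LA : Type x} [Membership PA LA] :
    Function.Surjective (dir : LA → Direction PA LA) :=
  Quot.mk_surjective

theorem Parallel.symm {PA : Type w} {LA : Type x} [Membership PA LA] {g h : LA}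
    (H : Parallel PA LA g h) : Parallel PA LA h g :=
  H.imp Eq.symm fun H P hP => H P hP.symm

namespace IsAffinePlane

variable {PA : Type w} {LA : Type x} [Membership PA LA]

theorem parallel_trans (hA : IsAffinePlane PA LA) {g h k : LA}
    (H₁ : Parallel PA LA g h) (H₂ : Parallel PA LA h k) : Parallel PA LA g k := by
  rcases H₁ with rfl | H₁
  · exact H₂
  rcases H₂ with rfl | H₂
  · exact Or.inr H₁
  by_contra hne
  simp only [Parallel, not_or, not_forall, not_not] at hne
  obtain ⟨hgk, X, hXg, hXk⟩ := hne
  have hXh : X ∉ h := fun hX => H₁ X ⟨hXg, hX⟩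
  exact hgk ((hA.existsUnique_parallel X h hXh).unique
    ⟨hXg, fun Q hQ => H₁ Q hQ.symm⟩ ⟨hXk, H₂⟩)

theorem dir_eq_iff (hA : IsAffinePlane PA LA) {g h : LA} :
    dir g = dir h ↔ Parallel PA LA g h :=
  Equivalence.quot_mk_eq_iff (r := Parallel PA LA)
    ⟨fun _ => Or.inl rfl, fun H => H.symm, fun H K => hA.parallel_trans H K⟩ g h

theorem line_unique (hA : IsAffinePlane PA LA) {X Y : PA} {g h : LA} (hXY : X ≠ Y)
    (hXg : X ∈ g) (hYg : Y ∈ g) (hXh : X ∈ h) (hYh : Y ∈ h) : g = h :=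
  (hA.existsUnique_line X Y hXY).unique ⟨hXg, hYg⟩ ⟨hXh, hYh⟩

theorem line_unique_of_dir (hA : IsAffinePlane PA LA) {X : PA} {g h : LA}
    (hd : dir g = dir h) (hXg : X ∈ g) (hXh : X ∈ h) : g = h :=
  (hA.dir_eq_iff.1 hd).resolve_right fun H => H X ⟨hXg, hXh⟩

theorem exists_line_dir (hA : IsAffinePlane PA LA) (X : PA) (d : Direction PA LA) :
    ∃ l : LA, X ∈ l ∧ dir l = d := by
  obtain ⟨g, rfl⟩ := dir_surjective d
  by_cases hX : X ∈ g
  · exact ⟨g, hX, rfl⟩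
  · obtain ⟨h, ⟨hXh, hd⟩, -⟩ := hA.existsUnique_parallel X g hX
    exact ⟨h, hXh, hA.dir_eq_iff.2 (Or.inr fun Q hQ => hd Q hQ.symm)⟩

theorem exists_meet (hA : IsAffinePlane PA LA) {g h : LA} (hd : dir g ≠ dir h) :
    ∃ X : PA, X ∈ g ∧ X ∈ h := by
  by_contra hne
  exact hd (hA.dir_eq_iff.2 (Or.inr fun X hX => hne ⟨X, hX⟩))

theorem meet_unique (hA : IsAffinePlane PA LA) {X Y : PA} {g h : LA} (hd : g ≠ h)
    (hXg : X ∈ g) (hXh : X ∈ h) (hYg : Y ∈ g) (hYh : Y ∈ h) : X = Y := by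
  by_contra hXY
  exact hd (hA.line_unique hXY hXg hYg hXh hYh)

theorem exists_not_mem (hA : IsAffinePlane PA LA) (l : LA) : ∃ X : PA, X ∉ l := by
  obtain ⟨P, Q, R, -, -, -, H⟩ := hA.exists_triangle
  by_contra! hl
  exact H l ⟨hl P, hl Q, hl R⟩

theorem exists_join (hA : IsAffinePlane PA LA) (X Y : PA) : ∃ l : LA, X ∈ l ∧ Y ∈ l := by
  by_cases hXY : X = Y
  · obtain ⟨P, Q, R, hPQ, -⟩ := hA.exists_triangle
    obtain ⟨Z, hZ⟩ : ∃ Z, X ≠ Z := by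
      by_contra! hZ
      exact hPQ ((hZ P).symm.trans (hZ Q))
    obtain ⟨l, ⟨hl, -⟩, -⟩ := hA.existsUnique_line X Z hZ
    exact ⟨l, hl, hXY ▸ hl⟩
  · exact (hA.existsUnique_line X Y hXY).exists

theorem exists_dir_ne (hA : IsAffinePlane PA LA) (l : LA) {X : PA} (hX : X ∈ l) :
    ∃ h : LA, X ∈ h ∧ dir h ≠ dir l := by
  obtain ⟨Y, hY⟩ := hA.exists_not_mem l
  obtain ⟨h, hXh, hYh⟩ := hA.exists_join X Y
  refine ⟨h, hXh, fun hd => hY ?_⟩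
  rwa [← hA.line_unique_of_dir hd hXh hX]

/-! ### Counting in an affine plane of order t -/

variable {t : ℕ}

theorem two_le (hA : IsAffinePlane PA LA) (hc : ∀ l : LA, {X : PA | X ∈ l}.encard = t) :
    2 ≤ t := by
  obtain ⟨P, Q, R, hPQ, -⟩ := hA.exists_triangle
  obtain ⟨l, hPl, hQl⟩ := hA.exists_join P Q
  have h : ({P, Q} : Set PA).encard ≤ {X : PA | X ∈ l}.encard :=
    Set.encard_le_encard (by rintro X (rfl | rfl) <;> assumption)
  rw [Set.encard_pair hPQ, hc l] at h
  exact_mod_cast h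

theorem exists_mem_ne (hA : IsAffinePlane PA LA) (hc : ∀ l : LA, {X : PA | X ∈ l}.encard = t)
    (l : LA) (X : PA) : ∃ Y, Y ∈ l ∧ Y ≠ X := by
  have h : 1 < {X : PA | X ∈ l}.encard := by
    rw [hc l]
    exact_mod_cast hA.two_le hc
  exact Set.exists_ne_of_one_lt_encard h X

/-- A line of another direction meets each line of the class in exactly one point. -/
theorem ncard_lines_dir (hA : IsAffinePlane PA LA) (hc : ∀ l : LA, {X : PA | X ∈ l}.encard = t)
    (d : Direction PA LA) : {l : LA | dir l = d}.ncard = t := by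
  obtain ⟨l, rfl⟩ := dir_surjective d
  obtain ⟨X, hX, -⟩ := hA.exists_mem_ne hc l hA.exists_triangle.choose
  obtain ⟨h, -, hd⟩ := hA.exists_dir_ne l hX
  choose f hf hfd using fun Y => hA.exists_line_dir Y (dir l)
  have hn : {X : PA | X ∈ h}.ncard = t := by rw [Set.ncard_def, hc h]; rfl
  rw [← hn]
  refine (Set.ncard_congr (fun Y _ => f Y) (fun Y _ => hfd Y) ?_ ?_).symm
  · intro Y Z hY hZ hYZ
    refine hA.meet_unique (g := h) (h := f Y) (fun he => hd ?_) hY (hf Y) hZ (hYZ ▸ hf Z)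
    rw [he, hfd]
  · intro k hk
    obtain ⟨Y, hYh, hYk⟩ := hA.exists_meet (g := h) (h := k) (by rw [hk]; exact hd)
    exact ⟨Y, hYh, hA.line_unique_of_dir ((hfd Y).trans hk.symm) (hf Y) hYk⟩

/-- For a line off `X`, these are the joins of `X` to its t points, together with its parallel
through `X`. -/
theorem ncard_lines_through (hA : IsAffinePlane PA LA)
    (hc : ∀ l : LA, {X : PA | X ∈ l}.encard = t) (X : PA) : {l : LA | X ∈ l}.ncard = t + 1 := by
  obtain ⟨l, hl⟩ : ∃ l : LA, X ∉ l := by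
    obtain ⟨h, hXh, -⟩ := hA.exists_join X X
    obtain ⟨Y, hY⟩ := hA.exists_not_mem h
    obtain ⟨k, hYk, hk⟩ := hA.exists_line_dir Y (dir h)
    refine ⟨k, fun hXk => hY ?_⟩
    rwa [← hA.line_unique_of_dir hk hXk hXh]
  obtain ⟨p, hXp, hp⟩ := hA.exists_line_dir X (dir l)
  choose f hXf hf using hA.exists_join (LA := LA) X
  have hfin : {Y : PA | Y ∈ l}.Finite := Set.finite_of_encard_eq_coe (hc l)
  have hn : {X : PA | X ∈ l}.ncard = t := by rw [Set.ncard_def, hc l]; rfl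
  have hinj : Set.InjOn f {Y : PA | Y ∈ l} := fun Y hY Z hZ hYZ =>
    hA.meet_unique (g := f Y) (h := l) (fun he => hl (he ▸ hXf Y)) (hf Y) hY (hYZ ▸ hf Z) hZ
  have heq : {k : LA | X ∈ k} = insert p (f '' {Y : PA | Y ∈ l}) := by
    ext k
    constructor
    · intro hk
      by_cases hd : dir k = dir l
      · exact Or.inl (hA.line_unique_of_dir (hd.trans hp.symm) hk hXp)
      · obtain ⟨Y, hYk, hYl⟩ := hA.exists_meet hd
        exact Or.inr ⟨Y, hYl, hA.line_unique (X := X) (Y := Y) (fun he => hl (he ▸ hYl)) (hXf Y) (hf Y) hk hYk⟩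
    · rintro (rfl | ⟨Y, -, rfl⟩)
      · exact hXp
      · exact hXf Y
  have hpn : p ∉ f '' {Y : PA | Y ∈ l} := by
    rintro ⟨Y, hY, rfl⟩
    exact hl (hA.line_unique_of_dir hp (hf Y) hY ▸ hXf Y)
  rw [heq, Set.ncard_insert_of_notMem hpn (hfin.image f), hinj.ncard_image, hn]

theorem card_direction (hA : IsAffinePlane PA LA)
    (hc : ∀ l : LA, {X : PA | X ∈ l}.encard = t) : Nat.card (Direction PA LA) = t + 1 := by
  have X := hA.exists_triangle.choose
  choose f hf hfd using hA.exists_line_dir X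
  rw [← hA.ncard_lines_through hc X, ← Set.ncard_univ]
  refine Set.ncard_congr (fun d _ => f d) (fun d _ => hf d) ?_ ?_
  · intro d e _ _ h
    rw [← hfd d, h, hfd e]
  · intro k hk
    exact ⟨dir k, trivial, hA.line_unique_of_dir (hfd _) (hf _) hk⟩

theorem finite_direction (hA : IsAffinePlane PA LA)
    (hc : ∀ l : LA, {X : PA | X ∈ l}.encard = t) : Finite (Direction PA LA) :=
  Nat.finite_of_card_ne_zero (by rw [hA.card_direction hc]; exact t.succ_ne_zero)

theorem finite_points (hA : IsAffinePlane PA LA)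
    (hc : ∀ l : LA, {X : PA | X ∈ l}.encard = t) : Finite PA := by
  have X := hA.exists_triangle.choose
  have hX : {l : LA | X ∈ l}.Finite :=
    Set.finite_of_ncard_ne_zero (by rw [hA.ncard_lines_through hc X]; exact t.succ_ne_zero)
  refine Set.finite_univ_iff.1 ((hX.biUnion fun l _ =>
    Set.finite_of_encard_eq_coe (hc l)).subset fun Y _ => ?_)
  obtain ⟨l, hl⟩ := hA.exists_join (LA := LA) X Y
  exact Set.mem_biUnion hl.1 hl.2

theorem finite_lines (hA : IsAffinePlane PA LA)
    (hc : ∀ l : LA, {X : PA | X ∈ l}.encard = t) : Finite LA := by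
  have := hA.finite_points hc
  refine Finite.of_injective (fun l : LA => {X : PA | X ∈ l}) fun g h hgh => ?_
  obtain ⟨X, hX, -⟩ := hA.exists_mem_ne hc g hA.exists_triangle.choose
  obtain ⟨Y, hY, hYX⟩ := hA.exists_mem_ne hc g X
  have hsub : ∀ Z, Z ∈ g → Z ∈ h := fun Z hZ => (Set.ext_iff.1 hgh Z).1 hZ
  exact hA.line_unique hYX hY hX (hsub Y hY) (hsub X hX)

end IsAffinePlane

/-! ### Uniform affine Hjelmslev planes -/

/-- `(φ, ψ)` makes `(Pt, Ln)` a `(t, t)`-AH plane over the affine plane `(PA, LA)`. -/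
structure IsUniformCover (t : ℕ) {Pt : Type u} {Ln : Type v} [Membership Pt Ln]
    {PA : Type w} {LA : Type x} [Membership PA LA] (φ : Pt → PA) (ψ : Ln → LA) : Prop where
  affine : IsAffinePlane PA LA
  exists_line : ∀ P Q : Pt, ∃ g : Ln, P ∈ g ∧ Q ∈ g
  surjective_points : Function.Surjective φ
  surjective_lines : Function.Surjective ψ
  map_mem : ∀ {P : Pt} {g : Ln}, P ∈ g → φ P ∈ ψ g
  points_eq_iff : ∀ {P Q : Pt}, φ P = φ Q ↔ PointNeighbour Pt Ln P Q
  lines_eq : ∀ {g h : Ln} {P Q : Pt}, P ≠ Q → P ∈ g → Q ∈ g → P ∈ h → Q ∈ h → ψ g = ψ h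
  parallel_of_disjoint : ∀ {g h : Ln}, (∀ P : Pt, ¬ (P ∈ g ∧ P ∈ h)) → Parallel PA LA (ψ g) (ψ h)
  encard_neighbours : ∀ {g : Ln} {P : Pt}, P ∈ g → {Q : Pt | Q ∈ g ∧ φ Q = φ P}.encard = t
  encard_points : ∀ g : Ln, {P : Pt | P ∈ g}.encard = (t * t : ℕ)

namespace IsUniformCover

variable {t : ℕ} {Pt : Type u} {Ln : Type v} [Membership Pt Ln]
  {PA : Type w} {LA : Type x} [Membership PA LA] {φ : Pt → PA} {ψ : Ln → LA}

theorem join_unique (hH : IsUniformCover t φ ψ) {P Q : Pt} {g h : Ln} (hPQ : φ P ≠ φ Q)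
    (hPg : P ∈ g) (hQg : Q ∈ g) (hPh : P ∈ h) (hQh : Q ∈ h) : g = h := by
  by_contra hgh
  exact hPQ (hH.points_eq_iff.2 ⟨g, h, hgh, hPg, hQg, hPh, hQh⟩)

theorem exists_meet (hH : IsUniformCover t φ ψ) {g h : Ln} (hd : dir (ψ g) ≠ dir (ψ h)) :
    ∃ P : Pt, P ∈ g ∧ P ∈ h := by
  by_contra hne
  exact hd (hH.affine.dir_eq_iff.2 (hH.parallel_of_disjoint fun P hP => hne ⟨P, hP⟩))

/-- A lift of a line through `X` in another direction cannot miss `g`, and the common point must lie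
over `X`. -/
theorem exists_mem_fibre (hH : IsUniformCover t φ ψ) {g : Ln} {X : PA} (hX : X ∈ ψ g) :
    ∃ P : Pt, P ∈ g ∧ φ P = X := by
  obtain ⟨l, hXl, hl⟩ := hH.affine.exists_dir_ne (ψ g) hX
  obtain ⟨h, rfl⟩ := hH.surjective_lines l
  obtain ⟨P, hPg, hPh⟩ := hH.exists_meet hl.symm
  exact ⟨P, hPg, hH.affine.meet_unique (fun he => hl (by rw [he]))
    (hH.map_mem hPg) (hH.map_mem hPh) hX hXl⟩

theorem encard_segment (hH : IsUniformCover t φ ψ) {g : Ln} {X : PA} (hX : X ∈ ψ g) :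
    {P : Pt | P ∈ g ∧ φ P = X}.encard = t := by
  obtain ⟨P, hP, rfl⟩ := hH.exists_mem_fibre hX
  exact hH.encard_neighbours hP

theorem pos (hH : IsUniformCover t φ ψ) : 0 < t := by
  obtain ⟨P, -⟩ := hH.surjective_points hH.affine.exists_triangle.choose
  obtain ⟨g, hg, -⟩ := hH.exists_line P P
  have h : {Q : Pt | Q ∈ g ∧ φ Q = φ P}.encard ≠ 0 := by
    rw [Set.encard_ne_zero]
    exact ⟨P, hg, rfl⟩
  rw [hH.encard_neighbours hg] at h
  exact Nat.pos_of_ne_zero (by exact_mod_cast h)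

/-- The t * t points of a lift are distributed over the points of `l` in fibres of size t. -/
theorem encard_line (hH : IsUniformCover t φ ψ) (l : LA) : {X : PA | X ∈ l}.encard = t := by
  classical
  obtain ⟨g, rfl⟩ := hH.surjective_lines l
  have hfin : {P : Pt | P ∈ g}.Finite := Set.finite_of_encard_eq_coe (hH.encard_points g)
  have himage : {X : PA | X ∈ ψ g} = (hfin.toFinset.image φ : Finset PA) := by
    ext X
    simp only [Set.mem_ofPred_eq, Finset.coe_image, Set.Finite.coe_toFinset, Set.mem_image]
    exact ⟨hH.exists_mem_fibre, fun ⟨P, hP, hX⟩ => hX ▸ hH.map_mem hP⟩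
  have hcard : hfin.toFinset.card = t * t := by
    have h := hH.encard_points g
    rw [hfin.encard_eq_coe_toFinset_card] at h
    exact_mod_cast h
  rw [Finset.card_eq_sum_card_image φ, Finset.sum_const_nat (m := t)] at hcard
  · rw [himage, Set.encard_coe_eq_coe_finsetCard]
    exact_mod_cast Nat.eq_of_mul_eq_mul_right hH.pos hcard
  · intro X hX
    have hXg : X ∈ ψ g := (Set.ext_iff.1 himage X).2 hX
    have h := hH.encard_segment hXg
    have hset : {P : Pt | P ∈ g ∧ φ P = X}
        = (hfin.toFinset.filter (fun P => φ P = X) : Finset Pt) := by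
      ext P
      simp
    rw [hset, Set.encard_coe_eq_coe_finsetCard] at h
    exact_mod_cast h

theorem two_le (hH : IsUniformCover t φ ψ) : 2 ≤ t :=
  hH.affine.two_le hH.encard_line

/-- Such lines correspond to the t points over some other point `Y` of `l` on a fixed line `g`
crossing `l` there: each of them meets `g` in one such point. -/
theorem ncard_lines_over (hH : IsUniformCover t φ ψ) {P : Pt} {l : LA} (hP : φ P ∈ l) :
    {h : Ln | P ∈ h ∧ ψ h = l}.ncard = t := by
  obtain ⟨Y, hYl, hY⟩ := hH.affine.exists_mem_ne hH.encard_line l (φ P)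
  obtain ⟨m, hYm, hm⟩ := hH.affine.exists_dir_ne l hYl
  obtain ⟨g, rfl⟩ := hH.surjective_lines m
  have hlg : l ≠ ψ g := fun he => hm (by rw [he])
  have hn : {Q : Pt | Q ∈ g ∧ φ Q = Y}.ncard = t := by
    rw [Set.ncard_def, hH.encard_segment hYm]
    rfl
  choose f hPf hf using hH.exists_line P
  have hψ : ∀ Q, φ Q = Y → ψ (f Q) = l := fun Q hQ =>
    hH.affine.line_unique (X := Y) (Y := φ P) hY (hQ ▸ hH.map_mem (hf Q)) (hH.map_mem (hPf Q))
      hYl hP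
  rw [← hn]
  refine (Set.ncard_congr (t := {h : Ln | P ∈ h ∧ ψ h = l}) (fun Q _ => f Q) (fun Q hQ => ⟨hPf Q, hψ Q hQ.2⟩) ?_ ?_).symm
  · rintro Q R ⟨hQg, hQ⟩ ⟨hRg, hR⟩ hQR
    by_contra hne
    refine hlg ?_
    rw [← hψ Q hQ]
    exact hH.lines_eq hne (hf Q) (hQR ▸ hf R) hQg hRg
  · rintro k ⟨hPk, rfl⟩
    obtain ⟨Q, hQk, hQg⟩ := hH.exists_meet (g := k) (h := g) hm.symm
    have hQ : φ Q = Y :=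
      hH.affine.meet_unique hlg (hH.map_mem hQk) (hH.map_mem hQg) hYl hYm
    exact ⟨Q, ⟨hQg, hQ⟩, hH.join_unique (by rw [hQ]; exact hY.symm) (hPf Q) (hf Q) hPk hQk⟩

theorem finite_lines_over (hH : IsUniformCover t φ ψ) {P : Pt} {l : LA} (hP : φ P ∈ l) :
    {h : Ln | P ∈ h ∧ ψ h = l}.Finite :=
  Set.finite_of_ncard_ne_zero (by rw [hH.ncard_lines_over hP]; exact hH.pos.ne')

theorem exists_line_over (hH : IsUniformCover t φ ψ) {P : Pt} {l : LA} (hP : φ P ∈ l) :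
    ∃ h : Ln, P ∈ h ∧ ψ h = l :=
  Set.nonempty_of_ncard_ne_zero (s := {h : Ln | P ∈ h ∧ ψ h = l})
    (by rw [hH.ncard_lines_over hP]; exact hH.pos.ne')

/-- From a point `R` outside the class, the class is covered by t lines over `l`, each containing t
of its points. -/
theorem fibre_card_le (hH : IsUniformCover t φ ψ) (X : PA) (s : Finset Pt)
    (hs : ∀ P ∈ s, φ P = X) : s.card ≤ t * t := by
  classical
  obtain ⟨l, hX, -⟩ := hH.affine.exists_join (LA := LA) X X
  obtain ⟨Y, hYl, hY⟩ := hH.affine.exists_mem_ne hH.encard_line l X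
  obtain ⟨R, rfl⟩ := hH.surjective_points Y
  have hfin := hH.finite_lines_over hYl
  have hcard : hfin.toFinset.card = t := by
    rw [← Set.ncard_eq_toFinset_card _ hfin, hH.ncard_lines_over hYl]
  have hsub : s ⊆ hfin.toFinset.biUnion fun h => s.filter (· ∈ h) := by
    intro P hP
    obtain ⟨h, hRh, hPh⟩ := hH.exists_line R P
    simp only [Finset.mem_biUnion, Set.Finite.mem_toFinset, Finset.mem_filter]
    refine ⟨h, ⟨hRh, ?_⟩, hP, hPh⟩
    exact hH.affine.line_unique hY (hH.map_mem hRh) (hs P hP ▸ hH.map_mem hPh) hYl hX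
  refine (Finset.card_le_card hsub).trans ?_
  refine (Finset.card_biUnion_le_card_mul _ _ t fun h hh => ?_).trans (by rw [hcard])
  have hψ : ψ h = l := ((Set.Finite.mem_toFinset hfin).1 hh).2
  have hle : ((s.filter (· ∈ h) : Finset Pt) : Set Pt).encard ≤ t := by
    rw [← hH.encard_segment (g := h) (X := X) (by rw [hψ]; exact hX)]
    refine Set.encard_le_encard fun P hP => ?_
    have hP' := Finset.mem_filter.1 hP
    exact ⟨hP'.2, hs P hP'.1⟩
  rw [Set.encard_coe_eq_coe_finsetCard] at hle
  exact_mod_cast hle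

/-- Two lines with the same image which share a point share its whole neighbourhood on them. -/
theorem mem_of_neighbour (hH : IsUniformCover t φ ψ) {g h : Ln} {P Q : Pt} (hgh : ψ g = ψ h)
    (hPg : P ∈ g) (hPh : P ∈ h) (hQg : Q ∈ g) (hQP : φ Q = φ P) : Q ∈ h := by
  classical
  by_contra hQh
  have hne : Nonempty Ln := ⟨g⟩
  -- One line `k l` through `P` over each `l`, with `h` itself chosen over `ψ h`; so a point `Q` off
  -- `h` escapes all of them.
  have hk : ∀ l : LA, φ P ∈ l → ∃ k : Ln, (P ∈ k ∧ ψ k = l) ∧ (l = ψ h → k = h) := by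
    intro l hl
    by_cases hlh : l = ψ h
    · exact ⟨h, ⟨hPh, hlh.symm⟩, fun _ => rfl⟩
    · obtain ⟨k, hk⟩ := hH.exists_line_over hl
      exact ⟨k, hk, fun he => (hlh he).elim⟩
  choose! k hkl hkh using hk
  have hfin : {l : LA | φ P ∈ l}.Finite := Set.finite_of_ncard_ne_zero
    (by rw [hH.affine.ncard_lines_through hH.encard_line]; exact t.succ_ne_zero)
  have hcard : hfin.toFinset.card = t + 1 := by
    rw [← Set.ncard_eq_toFinset_card _ hfin, hH.affine.ncard_lines_through hH.encard_line]
  have hsegfin : ∀ l, {R : Pt | R ∈ k l ∧ φ R = φ P}.Finite := fun l =>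
    (Set.finite_of_encard_eq_coe (hH.encard_points (k l))).subset fun R hR => hR.1
  let seg : LA → Finset Pt := fun l => (hsegfin l).toFinset.erase P
  have hmem : ∀ l R, R ∈ seg l ↔ R ≠ P ∧ R ∈ k l ∧ φ R = φ P := fun l R => by
    simp [seg]
  have hseg : ∀ l, φ P ∈ l → (seg l).card = t - 1 := by
    intro l hl
    have hPk := (hkl l hl).1
    rw [Finset.card_erase_of_mem (by simpa using hPk)]
    have h := hH.encard_neighbours hPk
    rw [(hsegfin l).encard_eq_coe_toFinset_card] at h
    rw [show (hsegfin l).toFinset.card = t by exact_mod_cast h]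
  have hunion : (hfin.toFinset.biUnion seg).card = (t + 1) * (t - 1) := by
    rw [Finset.card_biUnion, Finset.sum_const_nat (m := t - 1), hcard]
    · intro l hl
      exact hseg l (by simpa using hl)
    · intro l hl m hm hlm
      rw [Function.onFun, Finset.disjoint_left]
      intro R hRl hRm
      rw [hmem] at hRl hRm
      have hl' := hkl l (by simpa using hl)
      have hm' := hkl m (by simpa using hm)
      refine hlm ?_
      rw [← hl'.2, ← hm'.2]
      exact hH.lines_eq hRl.1 hRl.2.1 hl'.1 hRm.2.1 hm'.1
  have hPn : P ∉ hfin.toFinset.biUnion seg := by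
    simp [hmem]
  have hQP' : Q ≠ P := fun he => hQh (he ▸ hPh)
  have hQn : Q ∉ insert P (hfin.toFinset.biUnion seg) := by
    simp only [Finset.mem_insert, Finset.mem_biUnion, Set.Finite.mem_toFinset,
      Set.mem_ofPred_eq, hmem, not_or, not_exists, not_and]
    refine ⟨hQP', fun l hl _ hQk => (hQh ?_).elim⟩
    have hl' := hkl l hl
    have hlg : ψ g = ψ (k l) := hH.lines_eq hQP' hQg hPg hQk hl'.1
    rwa [hkh l hl (by rw [← hl'.2, ← hlg, hgh])] at hQk
  have hle := hH.fibre_card_le (φ P) (insert Q (insert P (hfin.toFinset.biUnion seg))) (by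
    intro R hR
    simp only [Finset.mem_insert, Finset.mem_biUnion, hmem] at hR
    rcases hR with rfl | rfl | ⟨l, -, -, -, hR⟩
    · exact hQP
    · rfl
    · exact hR)
  -- The class would contain (t + 1)(t - 1) + 2 = t² + 1 points.
  rw [Finset.card_insert_of_notMem hQn, Finset.card_insert_of_notMem hPn, hunion] at hle
  obtain ⟨s, rfl⟩ := Nat.exists_eq_add_of_le hH.two_le
  rw [show 2 + s - 1 = 1 + s by omega] at hle
  nlinarith

/-- Suppose `P` is off `g`. By `mem_of_neighbour`, a line through `P` over `ψ g` that meets `g` does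
so away from the class of `P`, and in a whole segment. Hence it is determined by one of the t - 1
points of `ψ g` other than `φ P`. Of the t lines through `P` over `ψ g`, exactly one remains. -/
theorem existsUnique_parallel (hH : IsUniformCover t φ ψ) {g : Ln} {P : Pt} (hP : φ P ∈ ψ g) :
    ∃! h : Ln, (P ∈ h ∧ ψ h = ψ g) ∧ Parallel Pt Ln g h := by
  by_cases hPg : P ∈ g
  · refine ⟨g, ⟨⟨hPg, rfl⟩, Or.inl rfl⟩, ?_⟩
    rintro h ⟨⟨hPh, -⟩, rfl | hd⟩
    · rfl
    · exact (hd P ⟨hPg, hPh⟩).elim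
  have hQ : ∀ Y : PA, Y ∈ ψ g → ∃ h : Ln, P ∈ h ∧ ∃ Q, Q ∈ g ∧ Q ∈ h ∧ φ Q = Y := by
    intro Y hY
    obtain ⟨Q, hQg, hQ⟩ := hH.exists_mem_fibre hY
    obtain ⟨h, hPh, hQh⟩ := hH.exists_line P Q
    exact ⟨h, hPh, Q, hQg, hQh, hQ⟩
  have hne : Nonempty Ln := ⟨g⟩
  have hne' : Nonempty Pt := ⟨P⟩
  choose! f hPf q hqg hqf hq using hQ
  set T : Set Ln := {h : Ln | P ∈ h ∧ ψ h = ψ g} with hT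
  have hTn : T.ncard = t := hH.ncard_lines_over hP
  have hTfin : T.Finite := hH.finite_lines_over hP
  set S : Set PA := {Y : PA | Y ∈ ψ g} \ {φ P} with hS
  have hSn : S.ncard = t - 1 := by
    rw [hS, Set.ncard_sdiff_singleton_of_mem (s := {Y : PA | Y ∈ ψ g}) hP, Set.ncard_def, hH.encard_line]
    rfl
  have hST : f '' S ⊆ T := by
    rintro _ ⟨Y, ⟨hY, hYP⟩, rfl⟩
    refine ⟨hPf Y hY, hH.affine.line_unique (X := Y) (Y := φ P) hYP ?_
      (hH.map_mem (hPf Y hY)) hY hP⟩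
    have h := hH.map_mem (hqf Y hY)
    rwa [hq Y hY] at h
  have hinj : Set.InjOn f S := by
    rintro Y ⟨hY, -⟩ Z ⟨hZ, -⟩ hYZ
    by_contra hne
    refine hPg ?_
    rw [hH.join_unique (P := q Y) (Q := q Z) (g := g) (h := f Y) (by rwa [hq Y hY, hq Z hZ])
      (hqg Y hY) (hqg Z hZ) (hqf Y hY) (hYZ ▸ hqf Z hZ)]
    exact hPf Y hY
  have hone : (T \ f '' S).ncard = 1 := by
    rw [Set.ncard_sdiff hST (hTfin.subset hST), hTn, hinj.ncard_image, hSn]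
    have := hH.pos
    omega
  have hmeet : ∀ k ∈ T, k ∈ f '' S ↔ ¬ Parallel Pt Ln g k := by
    rintro k ⟨hPk, hk⟩
    constructor
    · rintro ⟨Y, ⟨hY, -⟩, rfl⟩ (he | hd)
      · exact hPg (he ▸ hPk)
      · exact hd _ ⟨hqg Y hY, hqf Y hY⟩
    · intro hpar
      simp only [Parallel, not_or, not_forall, not_not] at hpar
      obtain ⟨-, X, hXg, hXk⟩ := hpar
      have hX : φ X ∈ ψ g := hH.map_mem hXg
      have hXP : φ X ≠ φ P := fun he =>
        hPg (hH.mem_of_neighbour hk hXk hXg hPk he.symm)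
      refine ⟨φ X, ⟨hX, hXP⟩, ?_⟩
      have hqk : q (φ X) ∈ k :=
        hH.mem_of_neighbour hk.symm hXg hXk (hqg _ hX) (hq _ hX)
      exact hH.join_unique (P := q (φ X)) (Q := P) (by rwa [hq _ hX]) (hqf _ hX) (hPf _ hX)
        hqk hPk
  obtain ⟨h, hh⟩ := Set.ncard_eq_one.1 hone
  have hmem : ∀ k, (k ∈ T ∧ Parallel Pt Ln g k) ↔ k = h := fun k => by
    rw [← Set.mem_singleton_iff, ← hh, Set.mem_sdiff]
    refine and_congr_right fun hk => ?_
    rw [hmeet k hk, not_not]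
  exact ⟨h, (hmem h).2 rfl, fun k hk => (hmem k).1 hk⟩

theorem parallel_trans (hH : IsUniformCover t φ ψ) {g h k : Ln} (hgh : ψ g = ψ h)
    (hhk : ψ h = ψ k) (H₁ : Parallel Pt Ln g h) (H₂ : Parallel Pt Ln h k) :
    Parallel Pt Ln g k := by
  by_contra hne
  simp only [Parallel, not_or, not_forall, not_not] at hne
  obtain ⟨hgk, X, hXg, hXk⟩ := hne
  exact hgk ((hH.existsUnique_parallel (g := h) (P := X) (hgh ▸ hH.map_mem hXg)).unique
    ⟨⟨hXg, hgh⟩, H₁.symm⟩ ⟨⟨hXk, hhk.symm⟩, H₂⟩)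

end IsUniformCover

/-! ### Labels: the traces of the lines at infinity -/

theorem IsAffinePlane.exists_transversal {PA : Type w} {LA : Type x} [Membership PA LA] {t : ℕ}
    (hA : IsAffinePlane PA LA) (hc : ∀ l : LA, {X : PA | X ∈ l}.encard = t) :
    ∃ τ : LA → Direction PA LA, (∀ l, τ l ≠ dir l) ∧
      (∀ l m, dir l = dir m → τ l = τ m → l = m) ∧
      ∀ d d', d' ≠ d → ∃ l, dir l = d ∧ τ l = d' := by
  have := hA.finite_lines hc
  have := hA.finite_direction hc
  have hf : ∀ d : Direction PA LA, ∃ f : LA → Direction PA LA,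
      Set.BijOn f {l | dir l = d} ({d}ᶜ : Set (Direction PA LA)) := by
    intro d
    have : Nonempty (Direction PA LA) := ⟨d⟩
    refine (Set.toFinite _).exists_bijOn_of_encard_eq ?_
    rw [← (Set.toFinite {l : LA | dir l = d}).cast_ncard_eq,
      ← (Set.toFinite ({d}ᶜ : Set (Direction PA LA))).cast_ncard_eq, hA.ncard_lines_dir hc,
      Set.ncard_compl, hA.card_direction hc, Set.ncard_singleton, Nat.add_sub_cancel]
  choose f hf using hf
  refine ⟨fun l => f (dir l) l, fun l => (hf (dir l)).mapsTo rfl, ?_, ?_⟩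
  · intro l m hlm h
    simp only [hlm] at h
    exact (hf (dir m)).injOn hlm rfl h
  · intro d d' hd
    obtain ⟨l, rfl, hl⟩ := (hf d).surjOn hd
    exact ⟨l, rfl, hl⟩

/-- `Λ` labels the lines of an affine Hjelmslev plane by lines of the affine plane below it, which
describe how the lines are to be extended to infinity. -/
structure IsLabelling {Pt : Type u} {Ln : Type v} [Membership Pt Ln] {PA : Type w} {LA : Type x}
    [Membership PA LA] (φ : Pt → PA) (ψ : Ln → LA) (Λ : Ln → LA) : Prop where
  dir_ne : ∀ g, dir (Λ g) ≠ dir (ψ g)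
  dir_eq_iff : ∀ {g h}, dir (ψ g) = dir (ψ h) → (dir (Λ g) = dir (Λ h) ↔ ψ g = ψ h)
  eq_iff : ∀ {g h}, ψ g = ψ h → (Λ g = Λ h ↔ Parallel Pt Ln g h)
  exists_line : ∀ (P : Pt) (d : Direction PA LA) (X : PA), ∃ g, P ∈ g ∧ dir (ψ g) = d ∧ X ∈ Λ g
  exists_two_lines : ∀ (d : Direction PA LA) (m : LA), dir m ≠ d →
    ∃ g h, g ≠ h ∧ dir (ψ g) = d ∧ dir (ψ h) = d ∧ Λ g = m ∧ Λ h = m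

theorem IsUniformCover.exists_neighbour_ne {t : ℕ} {Pt : Type u} {Ln : Type v}
    [Membership Pt Ln] {PA : Type w} {LA : Type x} [Membership PA LA] {φ : Pt → PA} {ψ : Ln → LA}
    (hH : IsUniformCover t φ ψ) {P : Pt} {g : Ln} (hPg : P ∈ g) :
    ∃ Q, Q ∈ g ∧ φ Q = φ P ∧ Q ≠ P := by
  have h : 1 < {Q : Pt | Q ∈ g ∧ φ Q = φ P}.encard := by
    rw [hH.encard_neighbours hPg]
    exact_mod_cast hH.two_le
  obtain ⟨Q, ⟨hQg, hQ⟩, hne⟩ := Set.exists_ne_of_one_lt_encard h P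
  exact ⟨Q, hQg, hQ, hne⟩

theorem IsUniformCover.exists_neighbour_not_mem {t : ℕ} {Pt : Type u} {Ln : Type v}
    [Membership Pt Ln] {PA : Type w} {LA : Type x} [Membership PA LA] {φ : Pt → PA} {ψ : Ln → LA}
    (hH : IsUniformCover t φ ψ) {P : Pt} {g : Ln} (hPg : P ∈ g) : ∃ Q, φ Q = φ P ∧ Q ∉ g := by
  obtain ⟨l, hl, hd⟩ := hH.affine.exists_dir_ne (ψ g) (hH.map_mem hPg)
  obtain ⟨h, hPh, rfl⟩ := hH.exists_line_over hl
  obtain ⟨Q, hQh, hQ, hQP⟩ := hH.exists_neighbour_ne hPh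
  exact ⟨Q, hQ, fun hQg => hd (by rw [hH.lines_eq hQP hQg hPg hQh hPh])⟩

/-- Fix a base point `B l` over each `l`. The class of `g` is represented by its parallel `b g`
through the base point, and `F l` matches the t lines over `l` through the base point with the t
lines of direction `τ l`. -/
theorem IsUniformCover.exists_labelling {t : ℕ} {Pt : Type u} {Ln : Type v} [Membership Pt Ln]
    {PA : Type w} {LA : Type x} [Membership PA LA] {φ : Pt → PA} {ψ : Ln → LA}
    (hH : IsUniformCover t φ ψ) : ∃ Λ : Ln → LA, IsLabelling φ ψ Λ := by
  have hA := hH.affine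
  have hc := hH.encard_line
  have := hA.finite_lines hc
  obtain ⟨τ, hτ, hτinj, hτsurj⟩ := hA.exists_transversal hc
  have hB : ∀ l : LA, ∃ P : Pt, φ P ∈ l := by
    intro l
    obtain ⟨X, hX, -⟩ := hA.exists_mem_ne hc l hA.exists_triangle.choose
    obtain ⟨P, rfl⟩ := hH.surjective_points X
    exact ⟨P, hX⟩
  choose B hB using hB
  have hF : ∀ l : LA, ∃ F : Ln → LA,
      Set.BijOn F {h | B l ∈ h ∧ ψ h = l} {m | dir m = τ l} := by
    intro l
    have : Nonempty LA := ⟨l⟩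
    refine (hH.finite_lines_over (hB l)).exists_bijOn_of_encard_eq ?_
    rw [← (hH.finite_lines_over (hB l)).cast_ncard_eq, ← (Set.toFinite _).cast_ncard_eq,
      hA.ncard_lines_dir hc, hH.ncard_lines_over (hB l)]
  choose F hF using hF
  choose b hb hbu using fun g : Ln => hH.existsUnique_parallel (g := g) (hB (ψ g))
  have hdir : ∀ g, dir (F (ψ g) (b g)) = τ (ψ g) := fun g => (hF (ψ g)).mapsTo (hb g).1
  have hdir_iff : ∀ {g h}, dir (ψ g) = dir (ψ h) →
      (dir (F (ψ g) (b g)) = dir (F (ψ h) (b h)) ↔ ψ g = ψ h) := by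
    intro g h hgh
    rw [hdir, hdir]
    exact ⟨hτinj _ _ hgh, fun h => by rw [h]⟩
  have heq_iff : ∀ {g h}, ψ g = ψ h →
      (F (ψ g) (b g) = F (ψ h) (b h) ↔ Parallel Pt Ln g h) := by
    intro g h hgh
    have hbh : B (ψ g) ∈ b h ∧ ψ (b h) = ψ g := by
      rw [hgh]
      exact (hb h).1
    rw [← hgh, (hF (ψ g)).injOn.eq_iff (hb g).1 hbh]
    constructor
    · intro he
      exact hH.parallel_trans (hb g).1.2.symm (by rw [he, hbh.2, hgh]) (hb g).2
        (he ▸ (hb h).2.symm)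
    · intro hpar
      refine (hbu g (b h) ⟨hbh, ?_⟩).symm
      exact hH.parallel_trans hgh (by rw [hbh.2, hgh]) hpar (hb h).2
  -- Every class over `l` has a member through every point over `l`, so every line of direction `τ
  -- l` is a label there.
  have hlift : ∀ (P : Pt) (l m : LA), φ P ∈ l → dir m = τ l →
      ∃ g, P ∈ g ∧ ψ g = l ∧ F (ψ g) (b g) = m := by
    intro P l m hP hm
    obtain ⟨h, ⟨hBh, rfl⟩, rfl⟩ := (hF l).surjOn hm
    obtain ⟨g, ⟨⟨hPg, hg⟩, hpar⟩, -⟩ := hH.existsUnique_parallel (g := h) hP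
    refine ⟨g, hPg, hg, ?_⟩
    rw [hg, ← hbu g h ⟨⟨hg ▸ hBh, hg.symm⟩, hpar.symm⟩]
  refine ⟨fun g => F (ψ g) (b g), fun g => (hdir g).symm ▸ hτ _, hdir_iff, heq_iff, ?_, ?_⟩
  · intro P d X
    obtain ⟨l, hl, rfl⟩ := hA.exists_line_dir (φ P) d
    obtain ⟨m, hXm, hm⟩ := hA.exists_line_dir X (τ l)
    obtain ⟨g, hPg, rfl, rfl⟩ := hlift P l m hl hm
    exact ⟨g, hPg, rfl, hXm⟩
  · intro d m hm
    obtain ⟨l, rfl, hl⟩ := hτsurj d (dir m) hm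
    obtain ⟨g, hPg, rfl, rfl⟩ := hlift (B l) l m (hB l) hl.symm
    -- The member of the same class through a point off `g` is a second line with this label.
    obtain ⟨Q, hQ, hQg⟩ := hH.exists_neighbour_not_mem hPg
    obtain ⟨h, hQh, hh, hm'⟩ := hlift Q (ψ g) _ (hQ ▸ hB (ψ g)) hl.symm
    exact ⟨g, h, fun he => hQg (he ▸ hQh), rfl, by rw [hh], rfl, hm'⟩

/-! ### The projective closure of an affine plane -/

/-- The points of an affine plane, and its directions. -/
inductive ClosurePt (PA LA : Type) [Membership PA LA] : Type u
  | fin (X : PA) : ClosurePt PA LA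
  | inf (d : Direction PA LA) : ClosurePt PA LA

/-- The lines of an affine plane, and the line at infinity. -/
inductive ClosureLn (LA : Type) : Type v
  | fin (l : LA) : ClosureLn LA
  | inf : ClosureLn LA

section Closure

variable {PA LA : Type} [Membership PA LA]

/-- Incidence in the projective closure. -/
def ClosurePt.Inc : ClosurePt.{u} PA LA → ClosureLn.{v} LA → Prop
  | .fin X, .fin l => X ∈ l
  | .inf d, .fin l => dir l = d
  | .fin _, .inf => False
  | .inf _, .inf => True

instance : Membership (ClosurePt.{u} PA LA) (ClosureLn.{v} LA) := ⟨fun l X => X.Inc l⟩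

namespace Closure

@[simp] theorem fin_mem_fin {X : PA} {l : LA} :
    (ClosurePt.fin X : ClosurePt.{u} PA LA) ∈ (ClosureLn.fin l : ClosureLn.{v} LA) ↔ X ∈ l :=
  Iff.rfl

@[simp] theorem inf_mem_fin {d : Direction PA LA} {l : LA} :
    (ClosurePt.inf d : ClosurePt.{u} PA LA) ∈ (ClosureLn.fin l : ClosureLn.{v} LA) ↔ dir l = d :=
  Iff.rfl

@[simp] theorem fin_mem_inf {X : PA} :
    ¬ (ClosurePt.fin X : ClosurePt.{u} PA LA) ∈ (ClosureLn.inf : ClosureLn.{v} LA) :=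
  id

@[simp] theorem inf_mem_inf {d : Direction PA LA} :
    (ClosurePt.inf d : ClosurePt.{u} PA LA) ∈ (ClosureLn.inf : ClosureLn.{v} LA) :=
  trivial

end Closure

open Closure

theorem IsAffinePlane.closure_exists_meet (hA : IsAffinePlane PA LA) {g h : ClosureLn.{v} LA} :
    ∃ X : ClosurePt.{u} PA LA, X ∈ g ∧ X ∈ h := by
  rcases g with g | _ <;> rcases h with h | _
  · by_cases hd : dir g = dir h
    · exact ⟨.inf (dir h), hd, rfl⟩
    · obtain ⟨X, hX⟩ := hA.exists_meet hd
      exact ⟨.fin X, hX⟩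
  · exact ⟨.inf (dir g), rfl, trivial⟩
  · exact ⟨.inf (dir h), trivial, rfl⟩
  · obtain ⟨X, -⟩ := hA.exists_triangle
    obtain ⟨l, -⟩ := hA.exists_join (LA := LA) X X
    exact ⟨.inf (dir l), trivial, trivial⟩

theorem IsAffinePlane.closure_exists_join (hA : IsAffinePlane PA LA) {X Y : ClosurePt.{u} PA LA} :
    ∃ g : ClosureLn.{v} LA, X ∈ g ∧ Y ∈ g := by
  rcases X with X | d <;> rcases Y with Y | e
  · obtain ⟨l, hl⟩ := hA.exists_join (LA := LA) X Y
    exact ⟨.fin l, hl⟩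
  · obtain ⟨l, hl⟩ := hA.exists_line_dir X e
    exact ⟨.fin l, hl⟩
  · obtain ⟨l, hl⟩ := hA.exists_line_dir Y d
    exact ⟨.fin l, hl.symm⟩
  · exact ⟨.inf, trivial, trivial⟩

theorem IsAffinePlane.closure_eq_or_eq (hA : IsAffinePlane PA LA) {X Y : ClosurePt.{u} PA LA}
    {g h : ClosureLn.{v} LA} (hXg : X ∈ g) (hYg : Y ∈ g) (hXh : X ∈ h) (hYh : Y ∈ h) :
    X = Y ∨ g = h := by
  rcases g with g | _ <;> rcases h with h | _ <;> rcases X with X | d <;> rcases Y with Y | e <;>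
    simp_all
  · by_contra! hne
    exact hne.2 (hA.line_unique hne.1 hXg hYg hXh hYh)
  · exact hA.line_unique_of_dir (hYg.trans hYh.symm) hXg hXh
  · exact hA.line_unique_of_dir (hXg.trans hXh.symm) hYg hYh

/-- The projective closure of an affine plane is a projective plane. -/
@[reducible] noncomputable def IsAffinePlane.closure (hA : IsAffinePlane PA LA) :
    Configuration.ProjectivePlane (ClosurePt.{u} PA LA) (ClosureLn.{v} LA) where
  exists_point := by
    rintro (l | _)
    · obtain ⟨X, hX⟩ := hA.exists_not_mem l
      exact ⟨.fin X, hX⟩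
    · exact ⟨.fin hA.exists_triangle.choose, id⟩
  exists_line := by
    rintro (X | d)
    · exact ⟨.inf, id⟩
    · obtain ⟨l, hl, rfl⟩ := hA.exists_line_dir hA.exists_triangle.choose d
      obtain ⟨m, -, hm⟩ := hA.exists_dir_ne l hl
      exact ⟨.fin m, hm⟩
  eq_or_eq := hA.closure_eq_or_eq
  mkPoint := fun {_ _} _ => hA.closure_exists_meet.choose
  mkPoint_ax := fun {_ _} _ => hA.closure_exists_meet.choose_spec
  mkLine := fun {_ _} _ => hA.closure_exists_join.choose
  mkLine_ax := fun {_ _} _ => hA.closure_exists_join.choose_spec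
  exists_config := by
    obtain ⟨Q, P, R, hQP, hQR, hPR, H⟩ := hA.exists_triangle
    obtain ⟨l, hPl, hRl⟩ := hA.exists_join (LA := LA) P R
    obtain ⟨m, hQm, hRm⟩ := hA.exists_join (LA := LA) Q R
    -- The configuration consists of the triangle with the line at infinity, the side `PR`, and the
    -- parallel to `QR` through `P`.
    obtain ⟨k, hPk, hk⟩ := hA.exists_line_dir P (dir m)
    have hPm : P ∉ m := fun hP => H m ⟨hQm, hP, hRm⟩
    refine ⟨.fin Q, .fin P, .fin R, .inf, .fin l, .fin k, fun hQ => H l ⟨hQ, hPl, hRl⟩,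
      fun hQ => ?_, id, hPl, hPk, id, hRl, fun hR => ?_⟩
    · exact hPm (hA.line_unique_of_dir hk hQ hQm ▸ hPk)
    · exact hPm (hA.line_unique_of_dir hk hR hRm ▸ hPk)

instance [Finite PA] [Finite (Direction PA LA)] : Finite (ClosurePt.{u} PA LA) :=
  Finite.of_surjective
    (fun s : PA ⊕ Direction PA LA => Sum.elim ClosurePt.fin ClosurePt.inf s) (by
      rintro (X | d)
      · exact ⟨.inl X, rfl⟩
      · exact ⟨.inr d, rfl⟩)

instance [Finite LA] : Finite (ClosureLn.{v} LA) :=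
  Finite.of_surjective (fun s : Option LA => s.elim ClosureLn.inf ClosureLn.fin) (by
    rintro (l | _)
    · exact ⟨some l, rfl⟩
    · exact ⟨none, rfl⟩)

/-- The line at infinity carries the t + 1 directions. -/
theorem IsAffinePlane.order_closure (hA : IsAffinePlane PA LA) {t : ℕ}
    (hc : ∀ l : LA, {X : PA | X ∈ l}.encard = t) :
    letI := hA.closure.{u, v}
    Configuration.ProjectivePlane.order (ClosurePt.{u} PA LA) (ClosureLn.{v} LA) = t := by
  let := hA.closure.{u, v}
  have := hA.finite_points hc
  have := hA.finite_lines hc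
  have := hA.finite_direction hc
  have h := Configuration.ProjectivePlane.pointCount_eq (ClosurePt.{u} PA LA)
    (ClosureLn.inf : ClosureLn.{v} LA)
  have e : Direction PA LA ≃
      {X : ClosurePt.{u} PA LA // X ∈ (ClosureLn.inf : ClosureLn.{v} LA)} :=
    Equiv.ofBijective (fun d => ⟨.inf d, trivial⟩) ⟨fun d e h => by simpa [Subtype.ext_iff] using h, by
      rintro ⟨X | d, hX⟩
      · exact hX.elim
      · exact ⟨d, rfl⟩⟩
  rw [Configuration.pointCount, ← Nat.card_congr e, hA.card_direction hc] at h
  exact (Nat.succ.inj h).symm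

end Closure

/-! ### The extension to infinity -/

/-- The points of the extension: the given points, and a copy of the affine plane for every
direction. -/
inductive ExtPt (Pt : Type u) {PA LA : Type} [Membership PA LA] {Ln : Type v}
    (ψ Λ : Ln → LA) : Type u
  | fin (P : Pt) : ExtPt Pt ψ Λ
  | inf (d : Direction PA LA) (X : PA) : ExtPt Pt ψ Λ

/-- The lines of the extension: the given lines, and a line for every point of the affine plane. -/
inductive ExtLn (PA : Type) {LA : Type} {Ln : Type v} (ψ Λ : Ln → LA) : Type v
  | fin (g : Ln) : ExtLn PA ψ Λ
  | inf (Y : PA) : ExtLn PA ψ Λ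

section Extension

variable {Pt : Type u} {Ln : Type v} [Membership Pt Ln] {PA LA : Type} [Membership PA LA]
  {φ : Pt → PA} {ψ Λ : Ln → LA} {t : ℕ}

/-- Incidence in the extension. -/
def ExtPt.Inc : ExtPt Pt ψ Λ → ExtLn PA ψ Λ → Prop
  | .fin P, .fin g => P ∈ g
  | .inf d X, .fin g => dir (ψ g) = d ∧ X ∈ Λ g
  | .fin _, .inf _ => False
  | .inf d X, .inf Y => ∃ l : LA, dir l = d ∧ X ∈ l ∧ Y ∈ l

instance : Membership (ExtPt Pt ψ Λ) (ExtLn PA ψ Λ) := ⟨fun l X => X.Inc l⟩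

namespace Extension

@[simp] theorem fin_mem_fin {P : Pt} {g : Ln} :
    (ExtPt.fin P : ExtPt Pt ψ Λ) ∈ (ExtLn.fin g : ExtLn PA ψ Λ) ↔ P ∈ g :=
  Iff.rfl

@[simp] theorem inf_mem_fin {d : Direction PA LA} {X : PA} {g : Ln} :
    (ExtPt.inf d X : ExtPt Pt ψ Λ) ∈ (ExtLn.fin g : ExtLn PA ψ Λ) ↔ dir (ψ g) = d ∧ X ∈ Λ g :=
  Iff.rfl

@[simp] theorem fin_mem_inf {P : Pt} {Y : PA} :
    ¬ (ExtPt.fin P : ExtPt Pt ψ Λ) ∈ (ExtLn.inf Y : ExtLn PA ψ Λ) :=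
  id

@[simp] theorem inf_mem_inf {d : Direction PA LA} {X Y : PA} :
    (ExtPt.inf d X : ExtPt Pt ψ Λ) ∈ (ExtLn.inf Y : ExtLn PA ψ Λ) ↔
      ∃ l : LA, dir l = d ∧ X ∈ l ∧ Y ∈ l :=
  Iff.rfl

/-- The points of the extension over the projective closure. -/
def mapPt (φ : Pt → PA) : ExtPt Pt ψ Λ → ClosurePt.{u} PA LA
  | .fin P => .fin (φ P)
  | .inf d _ => .inf d

/-- The lines of the extension over the projective closure. -/
def mapLn : ExtLn PA ψ Λ → ClosureLn.{v} LA
  | .fin g => .fin (ψ g)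
  | .inf _ => .inf

theorem exists_join (hH : IsUniformCover t φ ψ) (hΛ : IsLabelling φ ψ Λ) (P Q : ExtPt Pt ψ Λ) :
    ∃ g : ExtLn PA ψ Λ, P ∈ g ∧ Q ∈ g := by
  have hA := hH.affine
  rcases P with P | ⟨d, X⟩ <;> rcases Q with Q | ⟨e, Y⟩
  · obtain ⟨g, hg⟩ := hH.exists_line P Q
    exact ⟨.fin g, hg⟩
  · obtain ⟨g, hg⟩ := hΛ.exists_line P e Y
    exact ⟨.fin g, hg⟩
  · obtain ⟨g, hg⟩ := hΛ.exists_line Q d X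
    exact ⟨.fin g, hg.symm⟩
  · by_cases hde : d = e
    · subst hde
      obtain ⟨l, hX, hY⟩ := hA.exists_join (LA := LA) X Y
      -- In copy `d`, the lines of direction `d` are traces of new lines; all other lines are
      -- labels.
      by_cases hd : dir l = d
      · exact ⟨.inf Y, ⟨l, hd, hX, hY⟩, ⟨l, hd, hY, hY⟩⟩
      · obtain ⟨g, h, -, hg, -, rfl, -⟩ := hΛ.exists_two_lines d l hd
        exact ⟨.fin g, ⟨hg, hX⟩, ⟨hg, hY⟩⟩
    · obtain ⟨l, hX, rfl⟩ := hA.exists_line_dir X d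
      obtain ⟨m, hY, rfl⟩ := hA.exists_line_dir Y e
      obtain ⟨Z, hZl, hZm⟩ := hA.exists_meet hde
      exact ⟨.inf Z, ⟨l, rfl, hX, hZl⟩, ⟨m, rfl, hY, hZm⟩⟩

theorem join_unique (hH : IsUniformCover t φ ψ) (hΛ : IsLabelling φ ψ Λ) {P Q : ExtPt Pt ψ Λ}
    {g h : ExtLn PA ψ Λ} (hPQ : mapPt φ P ≠ mapPt φ Q) (hPg : P ∈ g) (hQg : Q ∈ g) (hPh : P ∈ h)
    (hQh : Q ∈ h) : g = h := by
  have hA := hH.affine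
  -- The direction and `P` fix the image of the line; `X` then fixes its label, hence its parallel
  -- class; and `P` fixes the line in that class.
  have key : ∀ {P : Pt} {d : Direction PA LA} {X : PA} {g h : Ln}, P ∈ g → P ∈ h →
      dir (ψ g) = d → dir (ψ h) = d → X ∈ Λ g → X ∈ Λ h → g = h := by
    intro P d X g h hPg hPh hg hh hXg hXh
    have hgh : dir (ψ g) = dir (ψ h) := hg.trans hh.symm
    have hψ : ψ g = ψ h := hA.line_unique_of_dir hgh (hH.map_mem hPg) (hH.map_mem hPh)
    have he := hA.line_unique_of_dir ((hΛ.dir_eq_iff hgh).2 hψ) hXg hXh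
    exact ((hΛ.eq_iff hψ).1 he).resolve_right fun hd => hd P ⟨hPg, hPh⟩
  rcases P with P | ⟨d, X⟩ <;> rcases Q with Q | ⟨e, Y⟩ <;> rcases g with g | Z <;>
    rcases h with h | W <;> simp only [fin_mem_fin, inf_mem_fin, fin_mem_inf, inf_mem_inf,
      mapPt, ne_eq, ClosurePt.fin.injEq, ClosurePt.inf.injEq, ExtLn.fin.injEq,
      ExtLn.inf.injEq] at *
  · exact hH.join_unique hPQ hPg hQg hPh hQh
  · exact key hPg hPh hQg.1 hQh.1 hQg.2 hQh.2
  · exact key hQg hQh hPg.1 hPh.1 hPg.2 hPh.2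
  · exact (hPQ (hPg.1.symm.trans hQg.1)).elim
  · exact (hPQ (hPg.1.symm.trans hQg.1)).elim
  · exact (hPQ (hPh.1.symm.trans hQh.1)).elim
  · obtain ⟨l, rfl, hXl, hZl⟩ := hPg
    obtain ⟨m, rfl, hYm, hZm⟩ := hQg
    obtain ⟨l', hl', hXl', hWl⟩ := hPh
    obtain ⟨m', hm', hYm', hWm⟩ := hQh
    obtain rfl := hA.line_unique_of_dir hl' hXl' hXl
    obtain rfl := hA.line_unique_of_dir hm' hYm' hYm
    exact hA.meet_unique (fun he => hPQ (by rw [he])) hZl hZm hWl hWm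

/-- At infinity, every line of a copy is the trace of at least two lines: of all new lines `.inf Z`
with `Z` on it, or of two lines with that label. -/
theorem pointNeighbour (hH : IsUniformCover t φ ψ) (hΛ : IsLabelling φ ψ Λ) {P Q : ExtPt Pt ψ Λ}
    (hPQ : mapPt φ P = mapPt φ Q) : PointNeighbour (ExtPt Pt ψ Λ) (ExtLn PA ψ Λ) P Q := by
  have hA := hH.affine
  rcases P with P | ⟨d, X⟩ <;> rcases Q with Q | ⟨e, Y⟩ <;>
    simp only [mapPt, ClosurePt.fin.injEq, ClosurePt.inf.injEq, reduceCtorEq] at hPQ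
  · obtain ⟨g, h, hgh, H⟩ := hH.points_eq_iff.1 hPQ
    exact ⟨.fin g, .fin h, by simpa using hgh, H⟩
  · subst hPQ
    obtain ⟨l, hX, hY⟩ := hA.exists_join (LA := LA) X Y
    by_cases hd : dir l = d
    · obtain ⟨Z, hZ, hZX⟩ := hA.exists_mem_ne hH.encard_line l X
      exact ⟨.inf Z, .inf X, by simpa using hZX, ⟨l, hd, hX, hZ⟩, ⟨l, hd, hY, hZ⟩,
        ⟨l, hd, hX, hX⟩, ⟨l, hd, hY, hX⟩⟩
    · obtain ⟨g, h, hgh, hg, hh, rfl, he⟩ := hΛ.exists_two_lines d l hd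
      exact ⟨.fin g, .fin h, by simpa using hgh, ⟨hg, hX⟩, ⟨hg, hY⟩, ⟨hh, he ▸ hX⟩,
        ⟨hh, he ▸ hY⟩⟩

/-- Parallel lines share a label, intersecting ones share a segment, and the new lines of `Z` and
`W` share the line `ZW` in the copy of its direction. -/
theorem lineNeighbour (hH : IsUniformCover t φ ψ) (hΛ : IsLabelling φ ψ Λ) {g h : ExtLn PA ψ Λ}
    (hgh : mapLn g = mapLn h) : LineNeighbour (ExtPt Pt ψ Λ) (ExtLn PA ψ Λ) g h := by
  have hA := hH.affine
  have two : ∀ l : LA, ∃ X Y, X ≠ Y ∧ X ∈ l ∧ Y ∈ l := fun l => by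
    obtain ⟨X, hX, -⟩ := hA.exists_mem_ne hH.encard_line l hA.exists_triangle.choose
    obtain ⟨Y, hY, hYX⟩ := hA.exists_mem_ne hH.encard_line l X
    exact ⟨X, Y, hYX.symm, hX, hY⟩
  rcases g with g | Z <;> rcases h with h | W <;>
    simp only [mapLn, ClosureLn.fin.injEq, reduceCtorEq] at hgh
  · by_cases hpar : Parallel Pt Ln g h
    · obtain ⟨X, Y, hXY, hX, hY⟩ := two (Λ g)
      have he := (hΛ.eq_iff hgh).2 hpar
      exact ⟨.inf (dir (ψ g)) X, .inf (dir (ψ g)) Y, by simpa using hXY, ⟨rfl, hX⟩, ⟨rfl, hY⟩,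
        ⟨by rw [hgh], he ▸ hX⟩, ⟨by rw [hgh], he ▸ hY⟩⟩
    · simp only [Parallel, not_or, not_forall, not_not] at hpar
      obtain ⟨-, P, hPg, hPh⟩ := hpar
      obtain ⟨Q, hQg, hQ, hQP⟩ := hH.exists_neighbour_ne hPg
      exact ⟨.fin Q, .fin P, by simpa using hQP, hQg, hPg,
        hH.mem_of_neighbour hgh hPg hPh hQg hQ, hPh⟩
  · obtain ⟨l, hZ, hW⟩ := hA.exists_join (LA := LA) Z W
    obtain ⟨X, Y, hXY, hX, hY⟩ := two l
    exact ⟨.inf (dir l) X, .inf (dir l) Y, by simpa using hXY, ⟨l, rfl, hX, hZ⟩, ⟨l, rfl, hY, hZ⟩,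
      ⟨l, rfl, hX, hW⟩, ⟨l, rfl, hY, hW⟩⟩

theorem exists_meet (hH : IsUniformCover t φ ψ) (hΛ : IsLabelling φ ψ Λ) (g h : ExtLn PA ψ Λ) :
    ∃ P : ExtPt Pt ψ Λ, P ∈ g ∧ P ∈ h := by
  have hA := hH.affine
  by_cases hgh : mapLn g = mapLn h
  · obtain ⟨P, Q, -, hPg, -, hPh, -⟩ := lineNeighbour hH hΛ hgh
    exact ⟨P, hPg, hPh⟩
  rcases g with g | Z <;> rcases h with h | W <;>
    simp only [mapLn, ClosureLn.fin.injEq, reduceCtorEq, not_true_eq_false] at hgh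
  · by_cases hd : dir (ψ g) = dir (ψ h)
    · obtain ⟨X, hXg, hXh⟩ := hA.exists_meet fun he => hgh ((hΛ.dir_eq_iff hd).1 he)
      exact ⟨.inf (dir (ψ g)) X, ⟨rfl, hXg⟩, ⟨hd.symm, hXh⟩⟩
    · obtain ⟨P, hP⟩ := hH.exists_meet hd
      exact ⟨.fin P, hP⟩
  · obtain ⟨l, hW, hl⟩ := hA.exists_line_dir W (dir (ψ g))
    -- A label never has the direction of its copy, so it crosses every trace of a new line there.
    obtain ⟨X, hXg, hXl⟩ := hA.exists_meet (g := Λ g) (h := l) (hl ▸ hΛ.dir_ne g)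
    exact ⟨.inf (dir (ψ g)) X, ⟨rfl, hXg⟩, ⟨l, hl, hXl, hW⟩⟩
  · obtain ⟨l, hZ, hl⟩ := hA.exists_line_dir Z (dir (ψ h))
    obtain ⟨X, hXh, hXl⟩ := hA.exists_meet (g := Λ h) (h := l) (hl ▸ hΛ.dir_ne h)
    exact ⟨.inf (dir (ψ h)) X, ⟨l, hl, hXl, hZ⟩, ⟨rfl, hXh⟩⟩

theorem map_mem (hH : IsUniformCover t φ ψ) {P : ExtPt Pt ψ Λ} {g : ExtLn PA ψ Λ} (hP : P ∈ g) :
    mapPt φ P ∈ mapLn g := by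
  rcases P with P | ⟨d, X⟩ <;> rcases g with g | Z
  · exact hH.map_mem hP
  · exact hP.elim
  · exact hP.1
  · trivial

theorem meet_unique (hH : IsUniformCover t φ ψ) (hΛ : IsLabelling φ ψ Λ) {P Q : ExtPt Pt ψ Λ}
    {g h : ExtLn PA ψ Λ} (hgh : mapLn g ≠ mapLn h) (hPg : P ∈ g) (hQg : Q ∈ g) (hPh : P ∈ h)
    (hQh : Q ∈ h) : P = Q := by
  have hA := hH.affine
  -- Distinct lines of the closure meet only once, so `P` and `Q` are both finite or lie in the same
  -- copy.
  have hPQ := (hA.closure_eq_or_eq (map_mem hH hPg) (map_mem hH hQg) (map_mem hH hPh)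
    (map_mem hH hQh)).resolve_right hgh
  rcases P with P | ⟨d, X⟩ <;> rcases Q with Q | ⟨e, Y⟩ <;> rcases g with g | Z <;>
    rcases h with h | W <;> simp only [fin_mem_fin, inf_mem_fin, fin_mem_inf, inf_mem_inf,
      mapPt, mapLn, ne_eq, ClosurePt.fin.injEq, ClosurePt.inf.injEq, ClosureLn.fin.injEq,
      reduceCtorEq, ExtPt.fin.injEq, ExtPt.inf.injEq, not_true_eq_false] at *
  · by_contra hne
    exact hgh (hH.lines_eq hne hPg hQg hPh hQh)
  · refine ⟨hPQ, hA.meet_unique (fun he => hgh ?_) hPg.2 hPh.2 hQg.2 hQh.2⟩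
    exact (hΛ.dir_eq_iff (hPg.1.trans hPh.1.symm)).1 (by rw [he])
  · obtain ⟨l, hl, hXl, hWl⟩ := hPh
    obtain ⟨m, hm, hYm, hWm⟩ := hQh
    obtain rfl := hA.line_unique_of_dir (hl.trans (hPQ.trans hm.symm)) hWl hWm
    refine ⟨hPQ, hA.meet_unique (fun he => hΛ.dir_ne g ?_) hPg.2 hXl hQg.2 hYm⟩
    rw [he, hl, hPg.1]
  · obtain ⟨l, hl, hXl, hWl⟩ := hPg
    obtain ⟨m, hm, hYm, hWm⟩ := hQg
    obtain rfl := hA.line_unique_of_dir (hl.trans (hPQ.trans hm.symm)) hWl hWm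
    refine ⟨hPQ, hA.meet_unique (fun he => hΛ.dir_ne h ?_) hPh.2 hXl hQh.2 hYm⟩
    rw [he, hl, hPh.1]

theorem pointNeighbour_iff (hH : IsUniformCover t φ ψ) (hΛ : IsLabelling φ ψ Λ)
    {P Q : ExtPt Pt ψ Λ} :
    mapPt φ P = mapPt φ Q ↔ PointNeighbour (ExtPt Pt ψ Λ) (ExtLn PA ψ Λ) P Q := by
  refine ⟨pointNeighbour hH hΛ, ?_⟩
  rintro ⟨g, h, hgh, hPg, hQg, hPh, hQh⟩
  by_contra hne
  exact hgh (join_unique hH hΛ hne hPg hQg hPh hQh)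

theorem lineNeighbour_iff (hH : IsUniformCover t φ ψ) (hΛ : IsLabelling φ ψ Λ)
    {g h : ExtLn PA ψ Λ} :
    mapLn g = mapLn h ↔ LineNeighbour (ExtPt Pt ψ Λ) (ExtLn PA ψ Λ) g h := by
  refine ⟨lineNeighbour hH hΛ, ?_⟩
  rintro ⟨P, Q, hPQ, hPg, hQg, hPh, hQh⟩
  by_contra hne
  exact hPQ (meet_unique hH hΛ hne hPg hQg hPh hQh)

/-- The neighbours on a line of a point at infinity form a line of A, namely a label or the trace of
a new line. -/
theorem neighbourCount (hH : IsUniformCover t φ ψ) (hΛ : IsLabelling φ ψ Λ) :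
    NeighbourCount (ExtPt Pt ψ Λ) (ExtLn PA ψ Λ) t := by
  have hA := hH.affine
  intro g P hP
  simp only [← pointNeighbour_iff hH hΛ]
  have hfin : Function.Injective (ExtPt.fin : Pt → ExtPt Pt ψ Λ) := fun _ _ h => by simpa using h
  have hinf : ∀ d, Function.Injective (ExtPt.inf d : PA → ExtPt Pt ψ Λ) :=
    fun _ _ _ h => by simpa using h
  rcases P with P | ⟨d, X⟩ <;> rcases g with g | Z
  · rw [← hH.encard_neighbours hP, ← hfin.encard_image]
    congr 1
    ext (Q | ⟨e, Y⟩) <;> simp [mapPt, eq_comm]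
  · exact hP.elim
  · rw [← hH.encard_line (Λ g), ← (hinf d).encard_image]
    congr 1
    have := hP.1
    ext (Q | ⟨e, Y⟩) <;> simp [mapPt, eq_comm]
    grind
  · obtain ⟨l, rfl, hX, hZ⟩ := hP
    rw [← hH.encard_line l, ← (hinf (dir l)).encard_image]
    congr 1
    ext (Q | ⟨e, Y⟩)
    · simp [mapPt]
    · simp only [mapPt, Set.mem_ofPred_eq, inf_mem_inf, ClosurePt.inf.injEq, Set.mem_image,
        ExtPt.inf.injEq]
      constructor
      · rintro ⟨⟨m, rfl, hY, hZm⟩, hm⟩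
        exact ⟨Y, hA.line_unique_of_dir hm hZ hZm ▸ hY, hm, rfl⟩
      · rintro ⟨Y, hY, rfl, rfl⟩
        exact ⟨⟨l, rfl, hY, hZ⟩, rfl⟩

theorem isPHPlane (hH : IsUniformCover t φ ψ) (hΛ : IsLabelling φ ψ Λ) :
    IsPHPlane t t (ExtPt Pt ψ Λ) (ExtLn PA ψ Λ) := by
  have hA := hH.affine
  have hc := hH.encard_line
  have := hA.finite_points hc
  have := hA.finite_lines hc
  have := hA.finite_direction hc
  obtain ⟨X₀, -⟩ := hA.exists_triangle
  refine ⟨neighbourCount hH hΛ, ClosurePt PA LA, ClosureLn LA, inferInstance, hA.closure,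
    mapPt φ, mapLn, ?_, inferInstance, inferInstance, hA.order_closure hc⟩
  refine ⟨exists_join hH hΛ, exists_meet hH hΛ, ⟨?_, ?_, fun _ _ => map_mem hH⟩,
    fun _ _ => pointNeighbour_iff hH hΛ, fun _ _ => lineNeighbour_iff hH hΛ⟩
  · rintro (X | d)
    · obtain ⟨P, rfl⟩ := hH.surjective_points X
      exact ⟨.fin P, rfl⟩
    · exact ⟨.inf d X₀, rfl⟩
  · rintro (l | _)
    · obtain ⟨g, rfl⟩ := hH.surjective_lines l
      exact ⟨.fin g, rfl⟩
    · exact ⟨.inf X₀, rfl⟩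

theorem isSubgeometry :
    IsSubgeometry (ExtPt.fin : Pt → ExtPt Pt ψ Λ) (ExtLn.fin : Ln → ExtLn PA ψ Λ) :=
  ⟨fun _ _ h => by simpa using h, fun _ _ h => by simpa using h, fun _ _ => Iff.rfl⟩

/-- The new lines form a single neighbour class, so any `Y` serves; they cover the points at
infinity because `.inf d X` lies on `.inf X`. -/
theorem isTruncation (hH : IsUniformCover t φ ψ) (hΛ : IsLabelling φ ψ Λ) (Y : PA) :
    IsTruncation (.inf Y) (ExtPt.fin : Pt → ExtPt Pt ψ Λ) (ExtLn.fin : Ln → ExtLn PA ψ Λ) := by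
  constructor
  · ext (P | ⟨d, X⟩)
    · simp only [Set.mem_range, ExtPt.fin.injEq, exists_eq, Set.mem_ofPred_eq, true_iff,
        ← lineNeighbour_iff hH hΛ]
      rintro (g | Z) hg
      · simp [mapLn] at hg
      · exact id
    · simp only [Set.mem_range, reduceCtorEq, exists_false, Set.mem_ofPred_eq, false_iff,
        ← lineNeighbour_iff hH hΛ]
      obtain ⟨l, hX, hl⟩ := hH.affine.exists_line_dir X d
      exact fun H => H (.inf X) rfl ⟨l, hl, hX, hX⟩
  · ext (g | Z) <;> simp [← lineNeighbour_iff hH hΛ, mapLn]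

end Extension

end Extension

/-! ### Replacing the affine plane by an isomorphic one -/

theorem IsAffinePlane.transfer {PA : Type w} {LA : Type x} [Membership PA LA]
    (hA : IsAffinePlane PA LA) {PA' LA' : Type} [Membership PA' LA'] (e : PA ≃ PA') (f : LA ≃ LA')
    (hef : ∀ X l, e X ∈ f l ↔ X ∈ l) : IsAffinePlane PA' LA' where
  existsUnique_line := by
    rw [e.surjective.forall₂]
    intro X Y hXY
    simpa [f.bijective.existsUnique_iff, hef] using
      hA.existsUnique_line X Y (fun h => hXY (by rw [h]))
  existsUnique_parallel := by
    rw [e.surjective.forall]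
    intro X
    rw [f.surjective.forall]
    intro l hl
    simpa [f.bijective.existsUnique_iff, e.surjective.forall, hef] using
      hA.existsUnique_parallel X l (by rwa [hef] at hl)
  exists_triangle := by
    obtain ⟨P, Q, R, hPQ, hPR, hQR, H⟩ := hA.exists_triangle
    refine ⟨e P, e Q, e R, e.injective.ne hPQ, e.injective.ne hPR, e.injective.ne hQR, ?_⟩
    rw [f.surjective.forall]
    simpa [hef] using H

theorem IsUniformCover.transfer {t : ℕ} {Pt : Type u} {Ln : Type v} [Membership Pt Ln]
    {PA : Type w} {LA : Type x} [Membership PA LA] {φ : Pt → PA} {ψ : Ln → LA}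
    (hH : IsUniformCover t φ ψ) {PA' LA' : Type} [Membership PA' LA'] (e : PA ≃ PA') (f : LA ≃ LA')
    (hef : ∀ X l, e X ∈ f l ↔ X ∈ l) : IsUniformCover t (e ∘ φ) (f ∘ ψ) where
  affine := hH.affine.transfer e f hef
  exists_line := hH.exists_line
  surjective_points := e.surjective.comp hH.surjective_points
  surjective_lines := f.surjective.comp hH.surjective_lines
  map_mem := fun h => (hef _ _).2 (hH.map_mem h)
  points_eq_iff := e.injective.eq_iff.trans hH.points_eq_iff
  lines_eq := fun hPQ hPg hQg hPh hQh => congrArg f (hH.lines_eq hPQ hPg hQg hPh hQh)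
  parallel_of_disjoint := fun h => (hH.parallel_of_disjoint h).imp (congrArg f) fun H => by
    rw [e.surjective.forall]
    simpa [hef] using H
  encard_neighbours := fun h => by simpa using hH.encard_neighbours h
  encard_points := hH.encard_points

/-- The points at infinity involve directions, which are classes of lines, yet must live in the
universe of `Pt`. The affine plane is finite, so a copy on `Fin` types in the lowest universe
removes the conflict. -/
theorem IsAHPlane.exists_cover {t : ℕ} {Pt : Type u} {Ln : Type v} [Membership Pt Ln]
    (H : IsAHPlane t t Pt Ln) : ∃ (PA LA : Type) (_ : Membership PA LA) (φ : Pt → PA)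
      (ψ : Ln → LA), IsUniformCover t φ ψ := by
  obtain ⟨hn, hp, PA, LA, _, φ, ψ, hA, hH⟩ := H
  have hcov : IsUniformCover t φ ψ :=
    { affine := hA
      exists_line := hH.exists_line
      surjective_points := hH.epi.surjective_points
      surjective_lines := hH.epi.surjective_lines
      map_mem := hH.epi.map_mem _ _
      points_eq_iff := hH.points_eq_iff _ _
      lines_eq := hH.lines_eq _ _ _ _
      parallel_of_disjoint := hH.parallel_of_disjoint _ _
      encard_neighbours := fun {g P} hP => by
        simpa only [← hH.points_eq_iff, eq_comm] using hn g P hP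
      encard_points := hp }
  have := hA.finite_points hcov.encard_line
  have := hA.finite_lines hcov.encard_line
  have e := Finite.equivFin PA
  have f := Finite.equivFin LA
  let : Membership (Fin (Nat.card PA)) (Fin (Nat.card LA)) := ⟨fun l X => e.symm X ∈ f.symm l⟩
  refine ⟨_, _, inferInstance, e ∘ φ, f ∘ ψ, hcov.transfer e f fun X l => ?_⟩
  change e.symm (e X) ∈ f.symm (f l) ↔ _
  rw [e.symm_apply_apply, f.symm_apply_apply]

end Hjelmslev

theorem mainTheorem4 (t : ℕ) (Pt : Type u) (Ln : Type v) [Membership Pt Ln]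
    (H : Hjelmslev.IsAHPlane t t Pt Ln) :
    ∃ (Pt' : Type u) (Ln' : Type v) (_ : Membership Pt' Ln'),
      Hjelmslev.IsPHPlane t t Pt' Ln' ∧
      ∃ (m : Ln') (i : Pt → Pt') (j : Ln → Ln'),
        Hjelmslev.IsSubgeometry i j ∧ Hjelmslev.IsTruncation m i j := by
  obtain ⟨PA, LA, _, φ, ψ, hH⟩ := H.exists_cover
  obtain ⟨Λ, hΛ⟩ := hH.exists_labelling
  obtain ⟨Y, -⟩ := hH.affine.exists_triangle
  exact ⟨Hjelmslev.ExtPt Pt ψ Λ, Hjelmslev.ExtLn PA ψ Λ, inferInstance,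
    Hjelmslev.Extension.isPHPlane hH hΛ, .inf Y, .fin, .fin,
    Hjelmslev.Extension.isSubgeometry, Hjelmslev.Extension.isTruncation hH hΛ Y⟩
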